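/- For a complex matrix $A=\{a_{jk}\}_{j,k\ge 0}$ and $0<p<\infty$, say that $A$ is a Schur multiplier of the Schatten–von Neumann class $S_p$ (of bounded operators on $\ell^2(\mathbb Z_+)$ whose singular values are $p$-summable, identified with their matrices in the standard basis) if for every matrix $B=\{b_{jk}\}$ of class $S_p$ the entrywise product $A\star B=\{a_{jk}b_{jk}\}$ is again the matrix of an operator of class $S_p$. For $0<p\le 1$ put $p_\#=p/(1-p)$ if $p<1$ and $p_\#=\infty$ (so $1/p_\#=0$) if $p=1$. Let $v\in C^\infty(\mathbb R)$ satisfy $v\ge 0$, $\operatorname{supp}v=[1/2,2]$ and $\sum_{n\ge 0}v(x/2^n)=1$ for $x\ge 1$, and let $V_n=\sum_{k\ge 0}v(k/2^n)z^k$ for $n\ge 1$, $V_0=\bar z+1+z$, $V_{n}=\overline{V_{-n}}$ for $n<0$. The Besov class $B^{s}_{2,q}$ ($s\in\mathbb R$, $0<q\le\infty$) consists of the distributions $\psi$ on the unit circle $\mathbb T$ such that $\{2^{|n|s}\,\|\psi*V_n\|_{L^2(\mathbb T)}\}_{n\in\mathbb Z}\in\ell^q(\mathbb Z)$. Theorem.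 Let $0<p\le 1$ and let $\psi\in B^{1/p_\#}_{2,\,p_\#}$. Then the Hankel matrix $\Gamma_\psi=\{\hat\psi(j+k)\}_{j,k\ge 0}$ is a Schur multiplier of $S_p$. -/

import Mathlib

open scoped ENNReal ContDiff

noncomputable section

namespace HankelSchur

/-! ## Schatten classes and Schur multipliers on `ℓ²(ℤ₊)` -/

/-- The complex Hilbert space `ℓ²` of square summable sequences indexed by `0, 1, 2, …`. -/
abbrev Ell2 : Type := lp (fun _ : ℕ => ℂ) 2

/-- The singular values `s_n(T) = inf {‖T - R‖ : rank R ≤ n}`, `n ≥ 0`, of a bounded operator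
on `ℓ²`. -/
def singularValue (T : Ell2 →L[ℂ] Ell2) (n : ℕ) : ℝ :=
  sInf {r : ℝ | ∃ R : Ell2 →L[ℂ] Ell2,
    LinearMap.rank (R : Ell2 →ₗ[ℂ] Ell2) ≤ (n : Cardinal) ∧ r = ‖T - R‖}

/-- The operator `T` belongs to the Schatten–von Neumann class `S_p`, `0 < p < ∞`:
its singular values are `p`-summable (so that `T` is in particular compact). -/
def IsSchatten (p : ℝ) (T : Ell2 →L[ℂ] Ell2) : Prop :=
  Summable fun n : ℕ => singularValue T n ^ p

/-- The matrix `{(T e_k, e_j)}_{j,k ≥ 0}` of `T` in the standard orthonormal basis of `ℓ²`. -/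
def matrixOf (T : Ell2 →L[ℂ] Ell2) : Matrix ℕ ℕ ℂ :=
  Matrix.of fun j k => (T (lp.single 2 k (1 : ℂ))) j

/-- The class `S_p`, viewed as a class of infinite matrices. -/
def schattenMatrices (p : ℝ) : Set (Matrix ℕ ℕ ℂ) :=
  {B | ∃ T : Ell2 →L[ℂ] Ell2, IsSchatten p T ∧ matrixOf T = B}

/-- The Schur multipliers of `S_p`: the matrices `A` such that the Schur (entrywise) product
of `A` with any matrix of class `S_p` is again of class `S_p`. -/
def schurMultipliers (p : ℝ) : Set (Matrix ℕ ℕ ℂ) :=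
  {A | ∀ B ∈ schattenMatrices p, Matrix.hadamard A B ∈ schattenMatrices p}

/-! ## Distributions on the unit circle -/

/-- The unit circle `𝕋`, parametrized by `t ↦ exp (i t)`, `t ∈ ℝ / 2πℤ`. -/
abbrev Torus : Type := AddCircle (2 * Real.pi)

instance factTwoPiPos : Fact (0 < 2 * Real.pi) := ⟨Real.two_pi_pos⟩

/-- The space `C^∞(𝕋)` of smooth complex functions on the circle. -/
def TestFunction : Submodule ℂ (Torus → ℂ) where
  carrier := {f | ContDiff ℝ ∞ fun x : ℝ => f (x : Torus)}
  add_mem' {f g} hf hg :=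
    (ContDiff.add hf hg : ContDiff ℝ ∞ fun x : ℝ => f (x : Torus) + g (x : Torus))
  zero_mem' := (contDiff_const : ContDiff ℝ ∞ fun _ : ℝ => (0 : ℂ))
  smul_mem' c f hf :=
    (ContDiff.mul contDiff_const hf : ContDiff ℝ ∞ fun x : ℝ => c * f (x : Torus))

/-- The character `z ↦ z ^ k` as a smooth function on the circle. -/
def zpow (k : ℤ) : TestFunction :=
  ⟨fun t => fourier k t, by
    change ContDiff ℝ ∞ fun x : ℝ => fourier k (x : Torus)
    simp only [fourier_coe_apply]
    have h : ContDiff ℝ ∞ fun x : ℝ => (x : ℂ) := Complex.ofRealCLM.contDiff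
    exact ((contDiff_const.mul h).div_const _).cexp⟩

/-- The smooth function `s ↦ φ (t - s)`. -/
def reflect (φ : TestFunction) (t : Torus) : TestFunction :=
  ⟨fun s => φ.1 (t - s), by
    induction t using QuotientAddGroup.induction_on with
    | H t =>
      have h : ContDiff ℝ ∞ fun x : ℝ => φ.1 (x : Torus) := φ.2
      exact h.comp (contDiff_const.sub contDiff_id : ContDiff ℝ ∞ fun s : ℝ => t - s)⟩

/-- A distribution on the circle: a linear functional on `C^∞(𝕋)` which is bounded with
respect to some `C^N`-norm, i.e. continuous for the usual topology of `C^∞(𝕋)`. -/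
structure CircleDistribution where
  /-- the underlying linear functional -/
  toFun : TestFunction →ₗ[ℂ] ℂ
  continuous' : ∃ (C : ℝ) (N : ℕ), ∀ (f : TestFunction) (M : ℝ),
    (∀ k ≤ N, ∀ x : ℝ, ‖iteratedDeriv k (fun y : ℝ => f.1 (y : Torus)) x‖ ≤ M) →
      ‖toFun f‖ ≤ C * M

/-- The Fourier coefficient `ψ̂(k) = ⟨ψ, z ^ (-k)⟩`. -/
def CircleDistribution.coeff (ψ : CircleDistribution) (k : ℤ) : ℂ := ψ.toFun (zpow (-k))

/-- The convolution `(ψ * φ)(t) = ⟨ψ, φ (t - ·)⟩` of a distribution with a smooth function. -/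
def CircleDistribution.conv (ψ : CircleDistribution) (φ : TestFunction) : Torus → ℂ :=
  fun t => ψ.toFun (reflect φ t)

/-- The Hankel matrix `Γ_ψ = {ψ̂(j + k)}_{j,k ≥ 0}`. -/
def hankel (ψ : CircleDistribution) : Matrix ℕ ℕ ℂ :=
  Matrix.of fun j k => ψ.coeff ((j : ℤ) + (k : ℤ))

/-! ## Besov classes -/

/-- The functions `v` from which dyadic decompositions are built: `v ∈ C^∞(ℝ)`, `v ≥ 0`,
`supp v = [1/2, 2]` and `∑_{n ≥ 0} v(x / 2^n) = 1` for `x ≥ 1`. -/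
structure IsDyadicBump (v : ℝ → ℝ) : Prop where
  smooth : ContDiff ℝ ∞ v
  nonneg : ∀ x, 0 ≤ v x
  supp : tsupport v = Set.Icc (1 / 2) 2
  hasSum : ∀ x : ℝ, 1 ≤ x → HasSum (fun n : ℕ => v (x / 2 ^ n)) 1

/-- The trigonometric polynomials `V_n`, `n ∈ ℤ`: `V_n = ∑_{k ≥ 0} v(k / 2^n) z^k` for `n ≥ 1`
(only `k ≤ 2^(n+1)` contribute, because `v` vanishes off `[1/2, 2]`), `V_0 = z⁻¹ + 1 + z`, and
`V_n` is the complex conjugate of `V_{-n}` for `n ≤ -1`. -/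
def dyadicKernel (v : ℝ → ℝ) (n : ℤ) : TestFunction :=
  if n = 0 then zpow (-1) + zpow 0 + zpow 1
  else ∑ k ∈ Finset.range (2 ^ (n.natAbs + 1) + 1),
    ((v ((k : ℝ) / 2 ^ n.natAbs) : ℝ) : ℂ) • zpow (n.sign * (k : ℤ))

/-- The Besov class `B^s_{pq}` of distributions on the circle, `0 < p, q ≤ ∞`, `s ∈ ℝ`:
the sequence `2^(|n| s) ‖ψ * V_n‖_{L^p}`, `n ∈ ℤ`, belongs to `ℓ^q(ℤ)`.  The `L^p`-norm is that
of normalized Lebesgue measure; it is finite, as `ψ * V_n` is a trigonometric polynomial. -/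
def besov (v : ℝ → ℝ) (s : ℝ) (p q : ℝ≥0∞) : Set CircleDistribution :=
  {ψ | Memℓp (fun n : ℤ => (2 : ℝ) ^ ((n.natAbs : ℝ) * s) *
    (MeasureTheory.eLpNorm (ψ.conv (dyadicKernel v n)) p
      (AddCircle.haarAddCircle : MeasureTheory.Measure Torus)).toReal) q}

/-- The exponent `p_# = p / (1 - p)`, with `p_# = ∞` for `p = 1`. -/
def sharp (p : ℝ) : ℝ≥0∞ := if p = 1 then ⊤ else ENNReal.ofReal (p / (1 - p))

end HankelSchur

end

/-!
A Hankel matrix `Γ = {c_{j+k}}` whose symbol is in the given Besov class even multiplies `S₁` into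
`S_p`, and `S_p ⊆ S₁` because `p ≤ 1`. The mechanism is a factorization through Hilbert–Schmidt
operators.

An operator of class `S₁` has a matrix `b_{jk} = ∑ᵢ xᵢ(j) conj (yᵢ(k))` with `∑ ‖xᵢ‖²` and
`∑ ‖yᵢ‖²` finite (`isNuclear_of_summable`). No Schmidt expansion is needed: one telescopes
near-optimal approximants of rank `2 ^ k`. If the rows of a matrix `d` are bounded in `ℓ²`, then
`d_{jk} b_{jk}` is the inner product of the vectors `{xᵢ(j) d_{jl}}_{i,l}` and
`{yᵢ(k) δ_{kl}}_{i,l}`, both of which are the rows or columns of Hilbert–Schmidt operators; so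
`d ⋆ B` is of class `S₁` (`exists_summable_approxNumber_hadamard`). If, for `p < 1`, the `ℓ²`-norms
of the rows are dominated by a decreasing sequence `ρ ∈ ℓ^r` with `r = p_# = p / (1 - p)`, then
`d ⋆ B` is the product of the diagonal operator `ρ`, which is of class `S_r`, and an operator of
class `S₁`, so it is of class `S_p` as `1 / p = 1 / r + 1` (`exists_isSchatten_hadamard`).

The full rows of `Γ` need not be square summable, but those of its lower triangle `k ≤ j` are finite:
row `j` involves only `c_m` with `j ≤ m ≤ 2 j`, i.e. boundedly many dyadic blocks, and the Besov
condition controls exactly the `ℓ²`-norms of `c` on these (`dyadicCondition_of_mem_besov`). The upper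
triangle is the adjoint of a matrix of the same kind.

Singular values enter only through elementary properties of approximation numbers:
`s_{m+n}(S + T) ≤ s_m(S) + s_n(T)`, `s_{m+n}(S T) ≤ s_m(S) s_n(T)`, `s_n(T*) ≤ s_n(T)`, and
`∑ s_n(A)² ≤ ∑ ‖r_j‖²` for an operator with rows `r_j`.
-/

open scoped InnerProductSpace

noncomputable section

namespace HankelSchur

/-! ### Approximation numbers -/

variable {E F G : Type} [NormedAddCommGroup E] [NormedAddCommGroup F] [NormedAddCommGroup G]

/-- The approximation numbers `s_n(T) = inf {‖T - R‖ : rank R ≤ n}` of an operator between normed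
spaces; on `ℓ²` these are definitionally the singular values. The auxiliary spaces of the
factorizations below are `ℓ²` over other index types. -/
def approxNumber [NormedSpace ℂ E] [NormedSpace ℂ F] (T : E →L[ℂ] F) (n : ℕ) : ℝ :=
  sInf {r : ℝ | ∃ R : E →L[ℂ] F,
    LinearMap.rank (R : E →ₗ[ℂ] F) ≤ (n : Cardinal) ∧ r = ‖T - R‖}

section Normed

variable [NormedSpace ℂ E] [NormedSpace ℂ F] [NormedSpace ℂ G]

theorem approxNumber_le (T : E →L[ℂ] F) {n : ℕ} (R : E →L[ℂ] F)
    (hR : LinearMap.rank (R : E →ₗ[ℂ] F) ≤ (n : Cardinal)) : approxNumber T n ≤ ‖T - R‖ :=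
  csInf_le ⟨0, by rintro _ ⟨R, -, rfl⟩; exact norm_nonneg _⟩ ⟨R, hR, rfl⟩

theorem approxNumber_set_nonempty (T : E →L[ℂ] F) (n : ℕ) :
    {r : ℝ | ∃ R : E →L[ℂ] F,
      LinearMap.rank (R : E →ₗ[ℂ] F) ≤ (n : Cardinal) ∧ r = ‖T - R‖}.Nonempty :=
  ⟨‖T - 0‖, 0, by simp [LinearMap.rank_zero], rfl⟩

theorem approxNumber_nonneg (T : E →L[ℂ] F) (n : ℕ) : 0 ≤ approxNumber T n :=
  Real.sInf_nonneg (by rintro _ ⟨R, -, rfl⟩; exact norm_nonneg _)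

theorem exists_rank_le_norm_sub_lt (T : E →L[ℂ] F) (n : ℕ) {ε : ℝ} (hε : 0 < ε) :
    ∃ R : E →L[ℂ] F, LinearMap.rank (R : E →ₗ[ℂ] F) ≤ (n : Cardinal) ∧
      ‖T - R‖ < approxNumber T n + ε := by
  obtain ⟨_, ⟨R, hR, rfl⟩, h⟩ := Real.lt_sInf_add_pos (approxNumber_set_nonempty T n) hε
  exact ⟨R, hR, h⟩

theorem approxNumber_antitone (T : E →L[ℂ] F) : Antitone (approxNumber T) := by
  intro m n hmn
  refine le_csInf (approxNumber_set_nonempty T m) ?_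
  rintro _ ⟨R, hR, rfl⟩
  exact approxNumber_le T R (hR.trans (by exact_mod_cast hmn))

theorem approxNumber_le_norm (T : E →L[ℂ] F) (n : ℕ) : approxNumber T n ≤ ‖T‖ := by
  simpa using approxNumber_le T (n := n) 0 (by simp [LinearMap.rank_zero])

theorem approxNumber_add_le (S T : E →L[ℂ] F) (m n : ℕ) :
    approxNumber (S + T) (m + n) ≤ approxNumber S m + approxNumber T n := by
  refine le_of_forall_pos_le_add fun ε hε => ?_
  obtain ⟨P, hP, hP'⟩ := exists_rank_le_norm_sub_lt S m (half_pos hε)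
  obtain ⟨Q, hQ, hQ'⟩ := exists_rank_le_norm_sub_lt T n (half_pos hε)
  have hr : LinearMap.rank ((P + Q : E →L[ℂ] F) : E →ₗ[ℂ] F) ≤ ((m + n : ℕ) : Cardinal) := by
    push_cast
    exact (LinearMap.rank_add_le _ _).trans (add_le_add hP hQ)
  have h := approxNumber_le (S + T) (P + Q) hr
  have h2 : ‖S + T - (P + Q)‖ ≤ ‖S - P‖ + ‖T - Q‖ := by
    rw [add_sub_add_comm]; exact norm_add_le _ _
  linarith

theorem approxNumber_comp_le (S : F →L[ℂ] G) (T : E →L[ℂ] F) (m n : ℕ) :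
    approxNumber (S ∘L T) (m + n) ≤ approxNumber S m * approxNumber T n := by
  have key : ∀ ε > 0, approxNumber (S ∘L T) (m + n) ≤
      (approxNumber S m + ε) * (approxNumber T n + ε) := by
    intro ε hε
    obtain ⟨P, hP, hP'⟩ := exists_rank_le_norm_sub_lt S m hε
    obtain ⟨Q, hQ, hQ'⟩ := exists_rank_le_norm_sub_lt T n hε
    -- `S T - (P T + (S - P) Q) = (S - P) (T - Q)`, where `P` and `Q` approximate `S` and `T`.
    have hr : LinearMap.rank ((P ∘L T + (S - P) ∘L Q : E →L[ℂ] G) : E →ₗ[ℂ] G)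
        ≤ ((m + n : ℕ) : Cardinal) := by
      push_cast
      refine (LinearMap.rank_add_le _ _).trans (add_le_add ?_ ?_)
      · exact (LinearMap.rank_comp_le_left _ _).trans hP
      · exact (LinearMap.rank_comp_le_right _ _).trans hQ
    have h := approxNumber_le (S ∘L T) _ hr
    have h1 : S ∘L T - (P ∘L T + (S - P) ∘L Q) = (S - P) ∘L (T - Q) := by
      ext x; simp; abel
    rw [h1] at h
    refine h.trans ((ContinuousLinearMap.opNorm_comp_le _ _).trans ?_)
    exact mul_le_mul hP'.le hQ'.le (norm_nonneg _) ((norm_nonneg _).trans hP'.le)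
  have ht : Filter.Tendsto (fun ε : ℝ => (approxNumber S m + ε) * (approxNumber T n + ε))
      (nhdsWithin 0 (Set.Ioi 0)) (nhds ((approxNumber S m + 0) * (approxNumber T n + 0))) := by
    refine Filter.Tendsto.mono_left ?_ nhdsWithin_le_nhds
    exact Continuous.tendsto (by fun_prop) 0
  simp only [add_zero] at ht
  exact ge_of_tendsto ht (Filter.eventually_of_mem self_mem_nhdsWithin fun ε hε => key ε hε)

end Normed

section Hilbert

variable [InnerProductSpace ℂ E] [InnerProductSpace ℂ F]

theorem rank_adjoint_le [CompleteSpace E] [CompleteSpace F] (R : E →L[ℂ] F) {n : ℕ}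
    (hR : LinearMap.rank (R : E →ₗ[ℂ] F) ≤ (n : Cardinal)) :
    LinearMap.rank (ContinuousLinearMap.adjoint R : F →ₗ[ℂ] E) ≤ (n : Cardinal) := by
  set V := LinearMap.range (R : E →ₗ[ℂ] F) with hV
  have hfin : FiniteDimensional ℂ V :=
    Module.rank_lt_aleph0_iff.mp (lt_of_le_of_lt hR Cardinal.natCast_lt_aleph0)
  -- With `V` the range of `R`, `R = P_V R`, so `R* = R* P_V` factors through `V`.
  have h1 : V.starProjection ∘L R = R := by
    ext x
    exact V.starProjection_eq_self_iff.mpr ⟨x, rfl⟩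
  have h2 : ContinuousLinearMap.adjoint R = ContinuousLinearMap.adjoint R ∘L V.starProjection := by
    conv_lhs => rw [← h1, ContinuousLinearMap.adjoint_comp]
    congr 1
    exact (isSelfAdjoint_starProjection V).adjoint_eq
  rw [h2]
  refine (LinearMap.rank_comp_le_right _ _).trans (le_trans ?_ hR)
  change Module.rank ℂ _ ≤ Module.rank ℂ V
  refine Submodule.rank_mono ?_
  rintro _ ⟨x, rfl⟩
  exact V.starProjection_apply_mem x

theorem approxNumber_adjoint_le [CompleteSpace E] [CompleteSpace F] (T : E →L[ℂ] F) (n : ℕ) :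
    approxNumber (ContinuousLinearMap.adjoint T) n ≤ approxNumber T n := by
  refine le_csInf (approxNumber_set_nonempty T n) ?_
  rintro _ ⟨R, hR, rfl⟩
  have h := approxNumber_le (ContinuousLinearMap.adjoint T) _ (rank_adjoint_le R hR)
  rwa [← map_sub, LinearIsometryEquiv.norm_map] at h

/-! ### Hilbert–Schmidt operators -/

variable {J : Type}

theorem memℓp_two_iff_summable (f : J → ℂ) : Memℓp f 2 ↔ Summable fun j => ‖f j‖ ^ 2 := by
  rw [memℓp_gen_iff (by norm_num)]
  simp

theorem hasSum_sq_norm (f : lp (fun _ : J => ℂ) 2) : HasSum (fun j => ‖f j‖ ^ 2) (‖f‖ ^ 2) := by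
  have := lp.hasSum_norm (p := 2) (by norm_num) f
  simpa using this

/-- A square summable family of vectors is the family of rows of a (Hilbert–Schmidt) operator. -/
theorem exists_operator_of_rows (r : J → E) (hr : Summable fun j => ‖r j‖ ^ 2) :
    ∃ A : E →L[ℂ] lp (fun _ : J => ℂ) 2, ∀ u j, A u j = ⟪r j, u⟫_ℂ := by
  have hle : ∀ u j, ‖⟪r j, u⟫_ℂ‖ ^ 2 ≤ ‖r j‖ ^ 2 * ‖u‖ ^ 2 := fun u j => by
    rw [← mul_pow]
    exact pow_le_pow_left₀ (norm_nonneg _) (norm_inner_le_norm _ _) 2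
  have hs : ∀ u, Summable fun j => ‖⟪r j, u⟫_ℂ‖ ^ 2 := fun u =>
    Summable.of_nonneg_of_le (fun j => sq_nonneg _) (hle u) (hr.mul_right _)
  let L : E →ₗ[ℂ] lp (fun _ : J => ℂ) 2 :=
    { toFun := fun u => ⟨fun j => ⟪r j, u⟫_ℂ, (memℓp_two_iff_summable _).2 (hs u)⟩
      map_add' := fun u w => by ext j; exact inner_add_right _ _ _
      map_smul' := fun c u => by ext j; exact inner_smul_right _ _ _ }
  refine ⟨L.mkContinuous (Real.sqrt (∑' j, ‖r j‖ ^ 2)) fun u => ?_, fun u j => rfl⟩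
  have h1 : ‖L u‖ ^ 2 ≤ (∑' j, ‖r j‖ ^ 2) * ‖u‖ ^ 2 :=
    hasSum_le (hle u) (hasSum_sq_norm (L u)) (hr.hasSum.mul_right _)
  rw [← Real.sqrt_sq (norm_nonneg u), ← Real.sqrt_mul (tsum_nonneg fun j => sq_nonneg _)]
  exact Real.le_sqrt_of_sq_le h1

/-- The squared Hilbert–Schmidt norm dominates `∑ s_m(A)²`. Induction on the number of terms: if `u`
in the unit ball nearly attains `‖A‖`, deleting the component along `u` from every row lowers
`∑ ‖r_j‖²` by at least `‖A u‖² ≈ s_0(A)²`, changes `A` by an operator of rank one, and so shifts the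
approximation numbers by at most one place. -/
theorem sum_sq_approxNumber_le (M : ℕ) (r : J → E) (hr : Summable fun j => ‖r j‖ ^ 2)
    (A : E →L[ℂ] lp (fun _ : J => ℂ) 2) (hA : ∀ u j, A u j = ⟪r j, u⟫_ℂ) :
    ∑ m ∈ Finset.range M, approxNumber A m ^ 2 ≤ ∑' j, ‖r j‖ ^ 2 := by
  induction M generalizing r A with
  | zero => simpa using tsum_nonneg fun j => sq_nonneg ‖r j‖
  | succ M ih =>
    have key : ∀ u : E, ‖u‖ ≤ 1 → ∑ m ∈ Finset.range (M + 1), approxNumber A m ^ 2 ≤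
        ∑' j, ‖r j‖ ^ 2 + ‖A‖ ^ 2 - ‖A u‖ ^ 2 := by
      intro u hu
      set K : E →L[ℂ] lp (fun _ : J => ℂ) 2 := (innerSL ℂ u).smulRight (A u) with hK
      set r' : J → E := fun j => r j - ⟪u, r j⟫_ℂ • u with hr'
      have hnorm : ∀ j, ‖r' j‖ ^ 2 ≤ ‖r j‖ ^ 2 - ‖A u j‖ ^ 2 := by
        intro j
        rw [hr', hA, @norm_sub_sq ℂ, inner_smul_right, norm_smul, mul_pow]
        have h1 : RCLike.re (⟪u, r j⟫_ℂ * ⟪r j, u⟫_ℂ) = ‖⟪u, r j⟫_ℂ‖ ^ 2 := by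
          rw [inner_mul_symm_re_eq_norm, norm_mul, norm_inner_symm (r j) u, sq]
        have h2 : ‖⟪u, r j⟫_ℂ‖ ^ 2 * ‖u‖ ^ 2 ≤ ‖⟪u, r j⟫_ℂ‖ ^ 2 :=
          mul_le_of_le_one_right (sq_nonneg _) (pow_le_one₀ (norm_nonneg u) hu)
        have h3 : ‖⟪r j, u⟫_ℂ‖ = ‖⟪u, r j⟫_ℂ‖ := norm_inner_symm _ _
        rw [h1, h3]
        linarith
      have hAu := hasSum_sq_norm (A u)
      have hdiff := hr.hasSum.sub hAu
      have hrs : Summable fun j => ‖r' j‖ ^ 2 :=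
        Summable.of_nonneg_of_le (fun j => sq_nonneg _) hnorm hdiff.summable
      have hsum : ∑' j, ‖r' j‖ ^ 2 ≤ ∑' j, ‖r j‖ ^ 2 - ‖A u‖ ^ 2 :=
        hasSum_le hnorm hrs.hasSum hdiff
      have hA' : ∀ w j, (A - K) w j = ⟪r' j, w⟫_ℂ := by
        intro w j
        have h1 : (A - K) w j = A w j - ⟪u, w⟫_ℂ * A u j := rfl
        rw [h1, hA, hA, hr', inner_sub_left, inner_smul_left, inner_conj_symm, mul_comm]
      have h2 := ih r' hrs (A - K) hA'
      have hK1 : approxNumber K 1 ≤ 0 := by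
        have := approxNumber_le K (n := 1) K (by
          refine le_trans (b := Module.rank ℂ (Submodule.span ℂ {A u})) (Submodule.rank_mono ?_)
            ((rank_span_le _).trans (by simp))
          rintro _ ⟨w, rfl⟩
          exact Submodule.mem_span_singleton.2 ⟨⟪u, w⟫_ℂ, by simp [hK]⟩)
        simpa using this
      have h3 : ∀ m, approxNumber A (m + 1) ≤ approxNumber (A - K) m := fun m => by
        have := approxNumber_add_le (A - K) K m 1
        rw [sub_add_cancel] at this
        linarith
      rw [Finset.sum_range_succ']
      have h4 : ∑ m ∈ Finset.range M, approxNumber A (m + 1) ^ 2 ≤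
          ∑ m ∈ Finset.range M, approxNumber (A - K) m ^ 2 :=
        Finset.sum_le_sum fun m _ => pow_le_pow_left₀ (approxNumber_nonneg _ _) (h3 m) 2
      have h5 := pow_le_pow_left₀ (approxNumber_nonneg A 0) (approxNumber_le_norm A 0) 2
      linarith
    rcases (norm_nonneg A).eq_or_lt with h0 | h0
    · simpa [← h0] using key 0 (by simp)
    · have hlim : Filter.Tendsto (fun c : ℝ => ∑' j, ‖r j‖ ^ 2 + ‖A‖ ^ 2 - c ^ 2)
          (nhdsWithin ‖A‖ (Set.Iio ‖A‖)) (nhds (∑' j, ‖r j‖ ^ 2 + ‖A‖ ^ 2 - ‖A‖ ^ 2)) :=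
        (Continuous.tendsto (by fun_prop) _).mono_left nhdsWithin_le_nhds
      rw [add_sub_cancel_right] at hlim
      refine ge_of_tendsto hlim ?_
      filter_upwards [Ioo_mem_nhdsLT h0] with c hc
      obtain ⟨u, hu, hcu⟩ := A.exists_lt_apply_of_lt_opNorm hc.2
      have := key u hu.le
      have h6 := pow_le_pow_left₀ hc.1.le hcu.le 2
      linarith

theorem summable_sq_approxNumber (r : J → E) (hr : Summable fun j => ‖r j‖ ^ 2)
    (A : E →L[ℂ] lp (fun _ : J => ℂ) 2) (hA : ∀ u j, A u j = ⟪r j, u⟫_ℂ) :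
    Summable fun m => approxNumber A m ^ 2 :=
  summable_of_sum_range_le (fun _ => sq_nonneg _) fun M => sum_sq_approxNumber_le M r hr A hA

end Hilbert

/-! ### Schatten classes -/

theorem summable_of_summable_even {f : ℕ → ℝ} (h0 : ∀ n, 0 ≤ f n) (hf : Antitone f)
    (h : Summable fun n => f (2 * n)) : Summable f :=
  (h.hasSum.even_add_odd (Summable.of_nonneg_of_le (fun _ => h0 _)
    (fun n => hf (Nat.le_succ (2 * n))) h).hasSum).summable

section Normed

variable {E F G : Type} [NormedAddCommGroup E] [NormedAddCommGroup F] [NormedAddCommGroup G]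
  [NormedSpace ℂ E] [NormedSpace ℂ F] [NormedSpace ℂ G]

theorem approxNumber_rpow_antitone (T : E →L[ℂ] F) {p : ℝ} (hp : 0 ≤ p) :
    Antitone fun n => approxNumber T n ^ p := fun _ _ h =>
  Real.rpow_le_rpow (approxNumber_nonneg _ _) (approxNumber_antitone T h) hp

/-- Hölder's inequality for Schatten classes: `S_a S_b ⊆ S_p` if `1 / p = 1 / a + 1 / b`. -/
theorem summable_approxNumber_comp {p a b : ℝ} (hp : 0 < p)
    (hab : (a / p).HolderConjugate (b / p)) (S : F →L[ℂ] G) (T : E →L[ℂ] F)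
    (hS : Summable fun n => approxNumber S n ^ a) (hT : Summable fun n => approxNumber T n ^ b) :
    Summable fun n => approxNumber (S ∘L T) n ^ p := by
  refine summable_of_summable_even (fun n => Real.rpow_nonneg (approxNumber_nonneg _ _) _)
    (approxNumber_rpow_antitone _ hp.le) ?_
  refine Summable.of_nonneg_of_le (fun n => Real.rpow_nonneg (approxNumber_nonneg _ _) _)
    (fun n => ?_) ((hS.div_const (a / p)).add (hT.div_const (b / p)))
  have hs := approxNumber_nonneg S n
  have ht := approxNumber_nonneg T n
  have h1 : approxNumber (S ∘L T) (2 * n) ≤ approxNumber S n * approxNumber T n := by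
    rw [two_mul]; exact approxNumber_comp_le S T n n
  refine (Real.rpow_le_rpow (approxNumber_nonneg _ _) h1 hp.le).trans ?_
  rw [Real.mul_rpow hs ht]
  have h2 := Real.young_inequality_of_nonneg (Real.rpow_nonneg hs p) (Real.rpow_nonneg ht p) hab
  rwa [← Real.rpow_mul hs, ← Real.rpow_mul ht, mul_div_cancel₀ _ hp.ne',
    mul_div_cancel₀ _ hp.ne'] at h2

end Normed

theorem IsSchatten.add {p : ℝ} (hp0 : 0 < p) (hp1 : p ≤ 1) {S T : Ell2 →L[ℂ] Ell2}
    (hS : IsSchatten p S) (hT : IsSchatten p T) : IsSchatten p (S + T) := by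
  refine summable_of_summable_even (fun n => Real.rpow_nonneg (approxNumber_nonneg _ _) _)
    (approxNumber_rpow_antitone _ hp0.le) ?_
  refine Summable.of_nonneg_of_le (fun n => Real.rpow_nonneg (approxNumber_nonneg _ _) _)
    (fun n => ?_) (Summable.add hS hT)
  have h1 : approxNumber (S + T) (2 * n) ≤ approxNumber S n + approxNumber T n := by
    rw [two_mul]; exact approxNumber_add_le S T n n
  exact (Real.rpow_le_rpow (approxNumber_nonneg _ _) h1 hp0.le).trans
    (Real.rpow_add_le_add_rpow (approxNumber_nonneg _ _) (approxNumber_nonneg _ _) hp0.le hp1)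

theorem IsSchatten.adjoint {p : ℝ} (hp : 0 < p) {T : Ell2 →L[ℂ] Ell2} (hT : IsSchatten p T) :
    IsSchatten p (ContinuousLinearMap.adjoint T) :=
  Summable.of_nonneg_of_le (fun _ => Real.rpow_nonneg (approxNumber_nonneg _ _) _)
    (fun n => Real.rpow_le_rpow (approxNumber_nonneg _ _) (approxNumber_adjoint_le T n) hp.le) hT

theorem IsSchatten.summable_approxNumber {p : ℝ} (hp0 : 0 < p) (hp1 : p ≤ 1)
    {T : Ell2 →L[ℂ] Ell2} (hT : IsSchatten p T) : Summable fun n => approxNumber T n := by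
  refine Summable.of_norm_bounded_eventually_nat hT ?_
  -- Once `s_n ^ p < 1` one has `s_n ≤ 1`, hence `s_n ≤ s_n ^ p`.
  filter_upwards [(Summable.tendsto_atTop_zero hT).eventually_lt_const one_pos] with n hn
  have h0 := approxNumber_nonneg T n
  have h1 : approxNumber T n ≤ 1 := by
    by_contra! h
    exact absurd hn (not_lt.2 (Real.one_le_rpow h.le hp0.le))
  rw [Real.norm_of_nonneg h0]
  exact Real.self_le_rpow_of_le_one h0 h1 hp1

theorem matrixOf_add (S T : Ell2 →L[ℂ] Ell2) : matrixOf (S + T) = matrixOf S + matrixOf T := rfl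

theorem inner_single_left (k : ℕ) (f : Ell2) : ⟪lp.single 2 k (1 : ℂ), f⟫_ℂ = f k := by
  simp [lp.inner_single_left]

theorem matrixOf_adjoint (T : Ell2 →L[ℂ] Ell2) (j k : ℕ) :
    matrixOf (ContinuousLinearMap.adjoint T) j k = (starRingEnd ℂ) (matrixOf T k j) := by
  simp only [matrixOf, Matrix.of_apply]
  rw [← inner_single_left j, ContinuousLinearMap.adjoint_inner_right, ← inner_conj_symm,
    inner_single_left]

/-! ### Nuclear matrices -/

/-- The matrices `B = ∑ᵢ xᵢ ⊗ conj yᵢ` with `∑ ‖xᵢ‖²` and `∑ ‖yᵢ‖²` finite, the sum being taken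
entrywise; these are the products of two Hilbert–Schmidt matrices. The index type is arbitrary, so
that no enumeration has to be chosen. -/
def IsNuclear (B : Matrix ℕ ℕ ℂ) : Prop :=
  ∃ (I : Type) (x y : I → Ell2), (Summable fun i => ‖x i‖ ^ 2) ∧ (Summable fun i => ‖y i‖ ^ 2) ∧
    ∀ j k, HasSum (fun i => x i j * (starRingEnd ℂ) (y i k)) (B j k)

/-- Expanding in an orthonormal basis `b` of the range of `R`: take `x_a = ‖R‖^(1/2) b_a` and
`y_a = ‖R‖^(-1/2) R* b_a`. -/
theorem exists_factorization_of_rank_le (R : Ell2 →L[ℂ] Ell2) {n : ℕ}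
    (hR : LinearMap.rank (R : Ell2 →ₗ[ℂ] Ell2) ≤ (n : Cardinal)) :
    ∃ r ≤ n, ∃ x y : Fin r → Ell2, (∀ a, ‖x a‖ ^ 2 ≤ ‖R‖) ∧ (∀ a, ‖y a‖ ^ 2 ≤ ‖R‖) ∧
      ∀ j k, ∑ a, x a j * (starRingEnd ℂ) (y a k) = matrixOf R j k := by
  set V := LinearMap.range (R : Ell2 →ₗ[ℂ] Ell2) with hV
  have hfin : FiniteDimensional ℂ V :=
    Module.rank_lt_aleph0_iff.mp (lt_of_le_of_lt hR Cardinal.natCast_lt_aleph0)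
  have hrank : Module.finrank ℂ V ≤ n := Module.finrank_le_of_rank_le hR
  set b := stdOrthonormalBasis ℂ V
  have hb : ∀ a, ‖(b a : Ell2)‖ = 1 := fun a => b.orthonormal.1 a
  have hs : (Real.sqrt ‖R‖) ^ 2 = ‖R‖ := Real.sq_sqrt (norm_nonneg R)
  refine ⟨_, hrank, fun a => (Real.sqrt ‖R‖ : ℂ) • (b a : Ell2),
    fun a => ((Real.sqrt ‖R‖ : ℂ)⁻¹) • ContinuousLinearMap.adjoint R (b a : Ell2), ?_, ?_, ?_⟩
  · intro a
    rw [norm_smul, hb, mul_one, Complex.norm_real, Real.norm_of_nonneg (Real.sqrt_nonneg _), hs]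
  · intro a
    rw [norm_smul, norm_inv, Complex.norm_real, Real.norm_of_nonneg (Real.sqrt_nonneg _),
      mul_pow, inv_pow, hs]
    have h1 : ‖ContinuousLinearMap.adjoint R (b a : Ell2)‖ ≤ ‖R‖ := by
      have := (ContinuousLinearMap.adjoint R).le_opNorm (b a : Ell2)
      rwa [hb, mul_one, LinearIsometryEquiv.norm_map] at this
    rcases (norm_nonneg R).eq_or_lt with h0 | h0
    · simp [← h0]
    · rw [inv_mul_le_iff₀ h0, ← sq]
      exact pow_le_pow_left₀ (norm_nonneg _) h1 2
  · intro j k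
    set e : Ell2 := lp.single 2 k (1 : ℂ)
    by_cases h0 : R = 0
    · subst h0; simp [matrixOf]
    have hne : (Real.sqrt ‖R‖ : ℂ) ≠ 0 := by
      exact_mod_cast (Real.sqrt_pos.2 (norm_pos_iff.2 h0)).ne'
    have h1 : ∑ a, ⟪(b a : Ell2), R e⟫_ℂ • (b a : Ell2) = R e := by
      have := congrArg (Subtype.val) (b.sum_repr' (⟨R e, ⟨e, rfl⟩⟩ : V))
      simpa using this
    have h2 : matrixOf R j k = ∑ a, ⟪(b a : Ell2), R e⟫_ℂ * (b a : Ell2) j := by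
      have h3 := congrArg (fun v : Ell2 => ⟪lp.single 2 j (1 : ℂ), v⟫_ℂ) h1
      simp only [inner_sum, inner_smul_right, inner_single_left] at h3
      exact h3.symm
    rw [h2]
    refine Finset.sum_congr rfl fun a _ => ?_
    have h3 : ⟪(b a : Ell2), R e⟫_ℂ =
        (starRingEnd ℂ) ((ContinuousLinearMap.adjoint R (b a : Ell2)) k) := by
      rw [← inner_single_left k, ContinuousLinearMap.adjoint_inner_right, inner_conj_symm]
    rw [h3]
    simp only [lp.coeFn_smul, Pi.smul_apply, smul_eq_mul, map_mul, map_inv₀, Complex.conj_ofReal]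
    field_simp

theorem IsNuclear.add {A B : Matrix ℕ ℕ ℂ} (hA : IsNuclear A) (hB : IsNuclear B) :
    IsNuclear (A + B) := by
  obtain ⟨I, x, y, hx, hy, hxy⟩ := hA
  obtain ⟨I', x', y', hx', hy', hxy'⟩ := hB
  refine ⟨I ⊕ I', Sum.elim x x', Sum.elim y y', ?_, ?_, fun j k => ?_⟩
  · exact (HasSum.sum (f := fun i => ‖Sum.elim x x' i‖ ^ 2) hx.hasSum hx'.hasSum).summable
  · exact (HasSum.sum (f := fun i => ‖Sum.elim y y' i‖ ^ 2) hy.hasSum hy'.hasSum).summable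
  · exact HasSum.sum (f := fun i => Sum.elim x x' i j * (starRingEnd ℂ) (Sum.elim y y' i k))
      (hxy j k) (hxy' j k)

theorem isNuclear_of_rank_le (R : Ell2 →L[ℂ] Ell2) {n : ℕ}
    (hR : LinearMap.rank (R : Ell2 →ₗ[ℂ] Ell2) ≤ (n : Cardinal)) : IsNuclear (matrixOf R) := by
  obtain ⟨r, -, x, y, -, -, hxy⟩ := exists_factorization_of_rank_le R hR
  refine ⟨Fin r, x, y, Summable.of_finite, Summable.of_finite, fun j k => ?_⟩
  rw [← hxy j k]
  exact hasSum_fintype _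

theorem norm_apply_le (f : Ell2) (j : ℕ) : ‖f j‖ ≤ ‖f‖ :=
  lp.norm_apply_le_norm (p := 2) (by norm_num) f j

theorem summable_mul_conj {I : Type} {x y : I → Ell2} (hx : Summable fun i => ‖x i‖ ^ 2)
    (hy : Summable fun i => ‖y i‖ ^ 2) (j k : ℕ) :
    Summable fun i => x i j * (starRingEnd ℂ) (y i k) := by
  refine Summable.of_norm_bounded (hx.add hy) fun i => ?_
  rw [norm_mul, RCLike.norm_conj]
  have h4 := mul_le_mul (norm_apply_le (x i) j) (norm_apply_le (y i) k) (norm_nonneg _)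
    (norm_nonneg _)
  nlinarith [sq_nonneg (‖x i‖ - ‖y i‖), sq_nonneg ‖x i‖, sq_nonneg ‖y i‖]

theorem isNuclear_of_hasSum (D : ℕ → Ell2 →L[ℂ] Ell2) (N : ℕ → ℕ) (B : Matrix ℕ ℕ ℂ)
    (hr : ∀ k, LinearMap.rank (D k : Ell2 →ₗ[ℂ] Ell2) ≤ (N k : Cardinal))
    (hs : Summable fun k => (N k : ℝ) * ‖D k‖)
    (hB : ∀ j k, HasSum (fun i => matrixOf (D i) j k) (B j k)) : IsNuclear B := by
  choose r hrN x y hx hy hxy using fun k => exists_factorization_of_rank_le (D k) (hr k)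
  have hsum : ∀ z : (k : ℕ) → Fin (r k) → Ell2, (∀ k a, ‖z k a‖ ^ 2 ≤ ‖D k‖) →
      Summable fun i : Σ k, Fin (r k) => ‖z i.1 i.2‖ ^ 2 := by
    intro z hz
    refine (summable_sigma_of_nonneg fun _ => sq_nonneg _).2
      ⟨fun k => Summable.of_finite, Summable.of_nonneg_of_le
        (fun k => tsum_nonneg fun _ => sq_nonneg _) (fun k => ?_) hs⟩
    rw [tsum_fintype]
    refine (Finset.sum_le_card_nsmul _ _ _ fun a _ => hz k a).trans ?_
    rw [nsmul_eq_mul, Finset.card_univ, Fintype.card_fin]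
    exact mul_le_mul_of_nonneg_right (by exact_mod_cast hrN k) (norm_nonneg _)
  refine ⟨Σ k, Fin (r k), fun i => x i.1 i.2, fun i => y i.1 i.2, hsum x hx, hsum y hy,
    fun j k => ?_⟩
  have h1 : ∀ i, HasSum (fun a : Fin (r i) => x i a j * (starRingEnd ℂ) (y i a k))
      (matrixOf (D i) j k) := fun i => by
    rw [← hxy i j k]; exact hasSum_fintype _
  exact HasSum.sigma_of_hasSum (hB j k) h1 (summable_mul_conj (hsum x hx) (hsum y hy) j k)

theorem matrixOf_eq_inner (T : Ell2 →L[ℂ] Ell2) (j k : ℕ) :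
    matrixOf T j k = ⟪lp.single 2 j (1 : ℂ), T (lp.single 2 k (1 : ℂ))⟫_ℂ := by
  rw [inner_single_left]; rfl

theorem norm_matrixOf_le (T : Ell2 →L[ℂ] Ell2) (j k : ℕ) : ‖matrixOf T j k‖ ≤ ‖T‖ := by
  have h3 := T.le_opNorm (lp.single 2 k (1 : ℂ))
  rw [lp.norm_single (by norm_num), norm_one, mul_one] at h3
  exact (norm_apply_le (T (lp.single 2 k (1 : ℂ))) j).trans h3

/-- Every operator of class `S₁` has a nuclear matrix: if `R_k` is a near-optimal approximant of `T`
of rank at most `2 ^ k`, then `T = R_0 + ∑ (R_{k+1} - R_k)`, and `∑ 2 ^ k ‖R_{k+1} - R_k‖` converges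
by Cauchy condensation of `∑ s_n(T)`. -/
theorem isNuclear_of_summable (T : Ell2 →L[ℂ] Ell2) (hT : Summable fun n => approxNumber T n) :
    IsNuclear (matrixOf T) := by
  have hcond : Summable fun k : ℕ => (2 : ℝ) ^ k * approxNumber T (2 ^ k) :=
    (summable_condensed_iff_of_nonneg (approxNumber_nonneg T)
      fun m n _ h => approxNumber_antitone T h).2 hT
  -- The errors `4 ^ (-k)` remain summable after multiplication by the ranks `2 ^ k`.
  have hpos : ∀ k : ℕ, (0 : ℝ) < (1 / 4) ^ k := fun k => by positivity
  choose R hRr hRn using fun k : ℕ => exists_rank_le_norm_sub_lt T (2 ^ k) (hpos k)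
  set δ : ℕ → ℝ := fun k => approxNumber T (2 ^ k) + (1 / 4) ^ k with hδ
  have hδs : Summable fun k : ℕ => (2 : ℝ) ^ k * δ k := by
    have : Summable fun k : ℕ => (1 / 2 : ℝ) ^ k := summable_geometric_two
    refine (hcond.add this).congr fun k => ?_
    rw [mul_add, ← mul_pow]; norm_num
  have hδ0 : Filter.Tendsto δ Filter.atTop (nhds 0) := by
    refine (Summable.of_nonneg_of_le (fun k => ?_) (fun k => ?_) hδs).tendsto_atTop_zero
    · exact add_nonneg (approxNumber_nonneg _ _) (hpos k).le
    · exact le_mul_of_one_le_left (add_nonneg (approxNumber_nonneg _ _) (hpos k).le)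
        (one_le_pow₀ one_le_two)
  have hRlim : Filter.Tendsto R Filter.atTop (nhds T) := by
    rw [tendsto_iff_norm_sub_tendsto_zero]
    refine squeeze_zero (fun _ => norm_nonneg _) (fun k => ?_) hδ0
    rw [norm_sub_rev]; exact (hRn k).le
  set D : ℕ → Ell2 →L[ℂ] Ell2 := fun k => R (k + 1) - R k with hD
  have hDn : ∀ k, ‖D k‖ ≤ δ (k + 1) + δ k := fun k => by
    have : D k = (T - R k) - (T - R (k + 1)) := by simp [hD]
    rw [this]
    exact (norm_sub_le _ _).trans (by have := hRn k; have := hRn (k + 1); simp only [hδ]; linarith)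
  have hDr : ∀ k, LinearMap.rank (D k : Ell2 →ₗ[ℂ] Ell2) ≤ ((2 ^ (k + 2) : ℕ) : Cardinal) := by
    intro k
    have h1 : (D k : Ell2 →ₗ[ℂ] Ell2) = (R (k + 1) : Ell2 →ₗ[ℂ] Ell2) +
        ((-1 : ℂ) • LinearMap.id) ∘ₗ (R k : Ell2 →ₗ[ℂ] Ell2) := by
      ext v; simp [hD, sub_eq_add_neg]
    rw [h1]
    refine (LinearMap.rank_add_le _ _).trans ((add_le_add (hRr (k + 1))
      ((LinearMap.rank_comp_le_right _ _).trans (hRr k))).trans ?_)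
    norm_cast
    rw [pow_succ _ (k + 1), pow_succ]
    omega
  have hDsum : Summable fun k : ℕ => (2 : ℝ) ^ (k + 2) * ‖D k‖ := by
    have h1 := (summable_nat_add_iff 1).2 hδs
    refine Summable.of_nonneg_of_le (fun k => by positivity) (fun k => ?_)
      ((h1.mul_left 2).add (hδs.mul_left 4))
    have h2 : (2 : ℝ) ^ (k + 2) * ‖D k‖ ≤ 2 ^ (k + 2) * (δ (k + 1) + δ k) :=
      mul_le_mul_of_nonneg_left (hDn k) (by positivity)
    refine h2.trans (le_of_eq ?_)
    rw [pow_add, pow_add]; ring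
  have hDtel : ∀ j k, HasSum (fun i => matrixOf (D i) j k) (matrixOf (T - R 0) j k) := by
    intro j k
    have hc : Continuous fun S : Ell2 →L[ℂ] Ell2 => matrixOf S j k := by
      simp only [matrixOf_eq_inner]; fun_prop
    have hs : Summable fun i => matrixOf (D i) j k :=
      Summable.of_norm_bounded hDsum fun i => (norm_matrixOf_le (D i) j k).trans
        (le_mul_of_one_le_left (norm_nonneg _) (one_le_pow₀ one_le_two))
    refine (hs.hasSum_iff_tendsto_nat).2 ?_
    have h1 : ∀ n, ∑ i ∈ Finset.range n, matrixOf (D i) j k =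
        matrixOf (R n) j k - matrixOf (R 0) j k := fun n =>
      Finset.sum_range_sub (fun i => matrixOf (R i) j k) n
    simp only [h1]
    exact ((hc.tendsto T).comp hRlim).sub_const _
  have h1 := (isNuclear_of_rank_le (R 0) (hRr 0)).add (isNuclear_of_hasSum D (fun k => 2 ^ (k + 2))
    (matrixOf (T - R 0)) hDr (by simpa using hDsum) hDtel)
  rwa [← matrixOf_add, add_sub_cancel] at h1

/-! ### Schur multiplication of nuclear matrices -/

theorem summable_sq_norm_apply {I : Type} {x : I → Ell2} (hx : Summable fun i => ‖x i‖ ^ 2) :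
    Summable fun q : I × ℕ => ‖x q.1 q.2‖ ^ 2 := by
  refine (summable_prod_of_nonneg fun _ => sq_nonneg _).2
    ⟨fun i => (hasSum_sq_norm (x i)).summable, hx.congr fun i => ?_⟩
  exact (hasSum_sq_norm (x i)).tsum_eq.symm

/-- A matrix whose rows are bounded in `ℓ²` multiplies nuclear matrices into `S₁`: `d ⋆ B = A G`
with Hilbert–Schmidt operators `G : ℓ² → ℓ²(I × ℕ)` and `A : ℓ²(I × ℕ) → ℓ²`. -/
theorem exists_summable_approxNumber_hadamard {d B : Matrix ℕ ℕ ℂ} {C : ℝ}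
    (hd : ∀ j, Summable fun k => ‖d j k‖ ^ 2) (hC : ∀ j, ∑' k, ‖d j k‖ ^ 2 ≤ C)
    (hB : IsNuclear B) :
    ∃ T : Ell2 →L[ℂ] Ell2, matrixOf T = Matrix.hadamard d B ∧
      Summable fun n => approxNumber T n := by
  obtain ⟨I, x, y, hx, hy, hxy⟩ := hB
  have hxs := summable_sq_norm_apply hx
  have hys := summable_sq_norm_apply hy
  have hxj : ∀ j, Summable fun i => ‖x i j‖ ^ 2 := fun j => hxs.prod_symm.prod_factor j
  have hprod : ∀ j, Summable fun q : I × ℕ => ‖(starRingEnd ℂ) (x q.1 j * d j q.2)‖ ^ 2 := by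
    intro j
    refine ((hxj j).mul_of_nonneg (hd j) (fun _ => sq_nonneg _) (fun _ => sq_nonneg _)).congr
      fun q => ?_
    rw [RCLike.norm_conj, norm_mul, mul_pow]
  -- The rows of `A`.
  let a : ℕ → lp (fun _ : I × ℕ => ℂ) 2 := fun j =>
    ⟨fun q => (starRingEnd ℂ) (x q.1 j * d j q.2), (memℓp_two_iff_summable _).2 (hprod j)⟩
  have han : ∀ j, ‖a j‖ ^ 2 = (∑' i, ‖x i j‖ ^ 2) * ∑' k, ‖d j k‖ ^ 2 := by
    intro j
    rw [(hxj j).tsum_mul_tsum (hd j)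
      ((hxj j).mul_of_nonneg (hd j) (fun _ => sq_nonneg _) (fun _ => sq_nonneg _)),
      ← (hasSum_sq_norm (a j)).tsum_eq]
    refine tsum_congr fun q => ?_
    have hq : a j q = (starRingEnd ℂ) (x q.1 j * d j q.2) := rfl
    rw [hq, RCLike.norm_conj, norm_mul, mul_pow]
  have has : Summable fun j => ‖a j‖ ^ 2 := by
    refine Summable.of_nonneg_of_le (fun _ => sq_nonneg _) (fun j => ?_)
      (hxs.prod_symm.prod.mul_right C)
    rw [han]
    exact mul_le_mul_of_nonneg_left (hC j) (tsum_nonneg fun _ => sq_nonneg _)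
  -- The rows of `G`; its `k`-th column is `{conj (yᵢ(k)) δ_{kl}}_{i,l}`.
  let g : I × ℕ → Ell2 := fun q => lp.single 2 q.2 (y q.1 q.2)
  have hgs : Summable fun q => ‖g q‖ ^ 2 := by
    refine hys.congr fun q => ?_
    rw [lp.norm_single (by norm_num)]
  obtain ⟨A, hA⟩ := exists_operator_of_rows a has
  obtain ⟨G, hG⟩ := exists_operator_of_rows g hgs
  refine ⟨A ∘L G, ?_, ?_⟩
  · ext j k
    have hin : HasSum (fun q : I × ℕ => ⟪a j q, G (lp.single 2 k (1 : ℂ)) q⟫_ℂ)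
        (matrixOf (A ∘L G) j k) := by
      have : matrixOf (A ∘L G) j k = ⟪a j, G (lp.single 2 k (1 : ℂ))⟫_ℂ := hA _ _
      rw [this]
      exact lp.hasSum_inner _ _
    have hG' : ∀ q : I × ℕ, G (lp.single 2 k (1 : ℂ)) q =
        if q.2 = k then (starRingEnd ℂ) (y q.1 q.2) else 0 := by
      intro q
      rw [hG, lp.inner_single_left]
      by_cases h : q.2 = k
      · simp [h]
      · simp [h]
    have hinj : Function.Injective fun i : I => (i, k) := fun i i' h => congrArg Prod.fst h
    rw [← hinj.hasSum_iff] at hin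
    · have h2 := (hxy j k).mul_left (d j k)
      have he : ((fun q : I × ℕ => ⟪a j q, G (lp.single 2 k (1 : ℂ)) q⟫_ℂ) ∘ fun i : I => (i, k)) =
          fun i => d j k * (x i j * (starRingEnd ℂ) (y i k)) := by
        ext i
        have hq : a j (i, k) = (starRingEnd ℂ) (x i j * d j k) := rfl
        simp only [Function.comp_apply, hG', if_true, hq, RCLike.inner_apply, Complex.conj_conj]
        ring
      rw [he] at hin
      exact hin.unique h2
    · rintro ⟨i, k'⟩ hq
      rw [hG', if_neg, inner_zero_right]
      rintro rfl
      exact hq ⟨i, rfl⟩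
  · have h := summable_approxNumber_comp one_pos (a := 2) (b := 2)
      (by rw [div_one]; exact Real.HolderConjugate.two_two) A G
      (by simpa using summable_sq_approxNumber a has A hA)
      (by simpa using summable_sq_approxNumber g hgs G hG)
    simpa using h

theorem exists_diagonal (w : ℕ → ℝ) {C : ℝ} (hw : ∀ j, |w j| ≤ C) :
    ∃ D : Ell2 →L[ℂ] Ell2, (∀ u j, D u j = (w j : ℂ) * u j) ∧ ‖D‖ ≤ C := by
  have hC : 0 ≤ C := (abs_nonneg _).trans (hw 0)
  have hle : ∀ (u : Ell2) j, ‖(w j : ℂ) * u j‖ ^ 2 ≤ C ^ 2 * ‖u j‖ ^ 2 := fun u j => by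
    rw [norm_mul, mul_pow, Complex.norm_real]
    exact mul_le_mul_of_nonneg_right (pow_le_pow_left₀ (norm_nonneg _) (hw j) 2) (sq_nonneg _)
  have hs : ∀ u : Ell2, Summable fun j => ‖(w j : ℂ) * u j‖ ^ 2 := fun u =>
    Summable.of_nonneg_of_le (fun j => sq_nonneg _) (hle u)
      ((hasSum_sq_norm u).summable.mul_left _)
  let L : Ell2 →ₗ[ℂ] Ell2 :=
    { toFun := fun u => ⟨fun j => (w j : ℂ) * u j, (memℓp_two_iff_summable _).2 (hs u)⟩
      map_add' := fun u w => by ext j; exact mul_add _ _ _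
      map_smul' := fun c u => by ext j; exact mul_left_comm _ _ _ }
  have hb : ∀ u, ‖L u‖ ≤ C * ‖u‖ := fun u => by
    refine (sq_le_sq₀ (norm_nonneg _) (by positivity)).1 ?_
    rw [mul_pow]
    exact hasSum_le (hle u) (hasSum_sq_norm (L u)) ((hasSum_sq_norm u).mul_left _)
  exact ⟨L.mkContinuous C hb, fun u j => rfl, L.mkContinuous_norm_le hC hb⟩

/-- The approximation numbers of a decreasing nonnegative diagonal are at most its entries. -/
theorem exists_diagonal_antitone {ρ : ℕ → ℝ} (h0 : ∀ j, 0 ≤ ρ j) (hρ : Antitone ρ) :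
    ∃ D : Ell2 →L[ℂ] Ell2, (∀ u j, D u j = (ρ j : ℂ) * u j) ∧ ∀ n, approxNumber D n ≤ ρ n := by
  obtain ⟨D, hD, -⟩ := exists_diagonal ρ (C := ρ 0) fun j => by
    rw [abs_of_nonneg (h0 j)]; exact hρ (Nat.zero_le j)
  refine ⟨D, hD, fun n => ?_⟩
  -- `D'` is `D` with the first `n` diagonal entries deleted.
  obtain ⟨D', hD', hn⟩ := exists_diagonal (fun j => if j < n then 0 else ρ j) (C := ρ n)
    fun j => by
      split_ifs with h
      · simpa using h0 n
      · rw [abs_of_nonneg (h0 j)]; exact hρ (not_lt.1 h)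
  classical
  have hr : LinearMap.rank ((D - D' : Ell2 →L[ℂ] Ell2) : Ell2 →ₗ[ℂ] Ell2) ≤ (n : Cardinal) := by
    refine le_trans (b := Module.rank ℂ (Submodule.span ℂ
      (((Finset.range n).image fun j => (lp.single 2 j (1 : ℂ) : Ell2) : Finset Ell2) : Set Ell2)))
      (Submodule.rank_mono ?_) ((rank_span_finset_le _).trans ?_)
    · rintro _ ⟨u, rfl⟩
      have : (D - D') u = ∑ j ∈ Finset.range n, ((ρ j : ℂ) * u j) • (lp.single 2 j (1 : ℂ) : Ell2) := by
        ext i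
        have h1 : (D - D') u i = D u i - D' u i := rfl
        rw [h1, hD, hD']
        rw [← inner_single_left i (∑ j ∈ Finset.range n, _), inner_sum]
        simp only [inner_smul_right, inner_single_left, lp.single_apply, Pi.single_apply, mul_ite,
          mul_one, mul_zero, Finset.sum_ite_eq, Finset.mem_range]
        by_cases hi : i < n <;> simp [hi]
      change (D - D') u ∈ _
      rw [this]
      refine Submodule.sum_mem _ fun j hj => Submodule.smul_mem _ _ (Submodule.subset_span ?_)
      exact Finset.mem_coe.2 (Finset.mem_image_of_mem _ hj)
    · exact_mod_cast Finset.card_image_le.trans (Finset.card_range n).le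
  have h := approxNumber_le D _ hr
  rw [sub_sub_cancel] at h
  exact h.trans hn

/-- If the `ℓ²`-norms of the rows of `d` are dominated by a decreasing sequence `ρ ∈ ℓ^(p / (1 - p))`,
then `d` multiplies nuclear matrices into `S_p`: factor `d ⋆ B` as the diagonal `ρ` times `d' ⋆ B`,
where the rows of `d' = ρ⁻¹ d` lie in the unit ball of `ℓ²`. -/
theorem exists_isSchatten_hadamard {p : ℝ} (hp0 : 0 < p) (hp1 : p < 1) {d B : Matrix ℕ ℕ ℂ}
    {ρ : ℕ → ℝ} (h0 : ∀ j, 0 ≤ ρ j) (hρ : Antitone ρ)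
    (hs : Summable fun j => ρ j ^ (p / (1 - p)))
    (hd : ∀ j, Summable fun k => ‖d j k‖ ^ 2) (hdρ : ∀ j, ∑' k, ‖d j k‖ ^ 2 ≤ ρ j ^ 2)
    (hB : IsNuclear B) :
    ∃ T : Ell2 →L[ℂ] Ell2, matrixOf T = Matrix.hadamard d B ∧ IsSchatten p T := by
  obtain ⟨D, hD, hDn⟩ := exists_diagonal_antitone h0 hρ
  have hn : ∀ j k, ‖(ρ j : ℂ)⁻¹ * d j k‖ ^ 2 = (ρ j ^ 2)⁻¹ * ‖d j k‖ ^ 2 := fun j k => by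
    rw [norm_mul, norm_inv, Complex.norm_real, Real.norm_of_nonneg (h0 j), mul_pow, inv_pow]
  obtain ⟨T, hT, hTs⟩ := exists_summable_approxNumber_hadamard
    (d := Matrix.of fun j k => (ρ j : ℂ)⁻¹ * d j k) (C := 1)
    (fun j => by simpa only [Matrix.of_apply, hn] using (hd j).mul_left _)
    (fun j => by
      simp only [Matrix.of_apply, hn]
      rw [tsum_mul_left]
      exact inv_mul_le_one_of_le₀ (hdρ j) (sq_nonneg _)) hB
  refine ⟨D ∘L T, ?_, ?_⟩
  · ext j k
    have h1 : matrixOf (D ∘L T) j k = (ρ j : ℂ) * matrixOf T j k := hD _ _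
    rw [h1, hT]
    simp only [Matrix.hadamard_apply, Matrix.of_apply]
    -- Where `ρ j = 0`, and hence `(ρ j)⁻¹ = 0`, the row `j` of `d` vanishes.
    by_cases hz : ρ j = 0
    · have h2 : ‖d j k‖ ^ 2 ≤ 0 :=
        ((hd j).le_tsum k fun _ _ => sq_nonneg _).trans ((hdρ j).trans (by simp [hz]))
      have h3 : d j k = 0 := by simpa using le_antisymm h2 (sq_nonneg _)
      simp [h3]
    · have : (ρ j : ℂ) ≠ 0 := by exact_mod_cast hz
      field_simp
  · have h1p : 0 < 1 - p := by linarith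
    have hr : 0 < p / (1 - p) := div_pos hp0 h1p
    refine summable_approxNumber_comp hp0 (a := p / (1 - p)) (b := 1) ?_ D T ?_ (by simpa using hTs)
    · have e1 : p / (1 - p) / p = 1 / (1 - p) := by field_simp
      rw [e1, Real.holderConjugate_iff]
      refine ⟨(one_lt_div h1p).2 (by linarith), ?_⟩
      simp
    · exact Summable.of_nonneg_of_le (fun _ => Real.rpow_nonneg (approxNumber_nonneg _ _) _)
        (fun n => Real.rpow_le_rpow (approxNumber_nonneg _ _) (hDn n) hr.le) hs

/-! ### Hankel matrices -/

theorem tsum_tail_eq_add {b : ℕ → ℝ} (hb : Summable b) (n : ℕ) :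
    ∑' l, b (l + n) = b n + ∑' l, b (l + (n + 1)) := by
  rw [((summable_nat_add_iff n).2 hb).tsum_eq_zero_add, zero_add]
  simp only [add_assoc, add_comm 1 n]

theorem summable_two_pow_mul_tsum_tail {b : ℕ → ℝ} (h0 : ∀ n, 0 ≤ b n)
    (hb : Summable fun n : ℕ => (2 : ℝ) ^ n * b n) :
    Summable fun n : ℕ => (2 : ℝ) ^ n * ∑' l, b (l + n) := by
  have hbs : Summable b := Summable.of_nonneg_of_le h0
    (fun n => le_mul_of_one_le_left (h0 n) (one_le_pow₀ one_le_two)) hb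
  have htail : ∀ n, Summable fun l => b (l + n) := fun n => (summable_nat_add_iff n).2 hbs
  set τ : ℕ → ℝ := fun n => ∑' l, b (l + n) with hτ
  have hτ0 : ∀ n, 0 ≤ τ n := fun n => tsum_nonneg fun _ => h0 _
  have hrec : ∀ n, τ n = b n + τ (n + 1) := fun n => tsum_tail_eq_add hbs n
  set K := ∑' n : ℕ, (2 : ℝ) ^ n * b n
  have hbound : ∀ N : ℕ, (2 : ℝ) ^ N * τ N ≤ K := by
    intro N
    have h1 : (2 : ℝ) ^ N * τ N ≤ ∑' l : ℕ, (2 : ℝ) ^ (l + N) * b (l + N) := by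
      rw [hτ, ← tsum_mul_left]
      refine Summable.tsum_le_tsum (fun l => ?_) ((htail N).mul_left _)
        ((summable_nat_add_iff N).2 hb)
      exact mul_le_mul_of_nonneg_right (pow_le_pow_right₀ one_le_two (Nat.le_add_left N l)) (h0 _)
    refine h1.trans ?_
    have h2 := hb.sum_add_tsum_nat_add N
    have h3 : 0 ≤ ∑ i ∈ Finset.range N, (2 : ℝ) ^ i * b i :=
      Finset.sum_nonneg fun i _ => mul_nonneg (by positivity) (h0 i)
    linarith
  -- Summation by parts, from `τ n = b n + τ (n + 1)`.
  have hpart : ∀ N : ℕ, ∑ n ∈ Finset.range N, (2 : ℝ) ^ n * τ n ≤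
      2 * ∑ n ∈ Finset.range N, (2 : ℝ) ^ n * b n + 2 ^ N * τ N := by
    intro N
    induction N with
    | zero => simpa using hτ0 0
    | succ N ih =>
      rw [Finset.sum_range_succ, Finset.sum_range_succ]
      have h1 : (2 : ℝ) ^ N * τ N = 2 ^ N * b N + 2 ^ N * τ (N + 1) := by rw [hrec N, mul_add]
      rw [pow_succ]
      linarith
  refine summable_of_sum_range_le (c := 3 * K) (fun n => mul_nonneg (by positivity) (hτ0 n))
    fun N => ?_
  have h1 : ∑ n ∈ Finset.range N, (2 : ℝ) ^ n * b n ≤ K :=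
    hb.sum_le_tsum _ fun i _ => mul_nonneg (by positivity) (h0 i)
  linarith [hpart N, hbound N]

/-- The sum of `|c_m|²` over `2 ^ n - 1 ≤ m < 2 ^ (n + 2)`. This range contains `j, …, 2 j` for every
`j` with `Nat.log 2 j = n`; the lower end `2 ^ n - 1` makes this true for `j = 0` as well, since
`Nat.log 2 0 = 0`. -/
def dyadicEnergy (c : ℕ → ℂ) (n : ℕ) : ℝ :=
  ∑ m ∈ Finset.Ico (2 ^ n - 1) (2 ^ (n + 2)), ‖c m‖ ^ 2

theorem dyadicEnergy_nonneg (c : ℕ → ℂ) (n : ℕ) : 0 ≤ dyadicEnergy c n :=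
  Finset.sum_nonneg fun _ _ => sq_nonneg _

/-- The Besov condition in terms of the coefficients: if `E_n` is the dyadic energy and
`r = p / (1 - p)`, then `∑ 2 ^ n E_n ^ (r / 2) < ∞`, respectively `sup E_n < ∞` if `p = 1`. -/
def DyadicCondition (p : ℝ) (c : ℕ → ℂ) : Prop :=
  (p = 1 → ∃ C, ∀ n, dyadicEnergy c n ≤ C) ∧
  (p < 1 → Summable fun n : ℕ => (2 : ℝ) ^ n * dyadicEnergy c n ^ (p / (1 - p) / 2))

theorem summable_row_of_triangular {c : ℕ → ℂ} {d : Matrix ℕ ℕ ℂ}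
    (hd : ∀ j k, ‖d j k‖ ≤ if k ≤ j then ‖c (j + k)‖ else 0) (j : ℕ) :
    (Summable fun k => ‖d j k‖ ^ 2) ∧ ∑' k, ‖d j k‖ ^ 2 ≤ dyadicEnergy c (Nat.log 2 j) := by
  have hz : ∀ k ∉ Finset.range (j + 1), ‖d j k‖ ^ 2 = 0 := fun k hk => by
    have h := hd j k
    rw [if_neg (by simpa using hk)] at h
    simp [le_antisymm h (norm_nonneg _)]
  refine ⟨summable_of_ne_finset_zero hz, ?_⟩
  rw [tsum_eq_sum hz]
  have h1 : ∑ k ∈ Finset.range (j + 1), ‖d j k‖ ^ 2 ≤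
      ∑ k ∈ Finset.range (j + 1), ‖c (j + k)‖ ^ 2 :=
    Finset.sum_le_sum fun k hk => by
      have h := hd j k
      rw [if_pos (by simpa [Nat.lt_succ_iff] using hk)] at h
      exact pow_le_pow_left₀ (norm_nonneg _) h 2
  refine h1.trans ?_
  have h2 : ∑ k ∈ Finset.range (j + 1), ‖c (j + k)‖ ^ 2 =
      ∑ m ∈ Finset.Ico j (2 * j + 1), ‖c m‖ ^ 2 := by
    rw [Finset.sum_Ico_eq_sum_range]
    congr 2
    omega
  rw [h2]
  refine Finset.sum_le_sum_of_subset_of_nonneg (fun m hm => ?_) fun _ _ _ => sq_nonneg _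
  rw [Finset.mem_Ico] at hm ⊢
  have h3 : j < 2 ^ (Nat.log 2 j + 1) := Nat.lt_pow_succ_log_self one_lt_two j
  have h4 : 2 ^ Nat.log 2 j ≤ j + 1 := by
    rcases Nat.eq_zero_or_pos j with rfl | hj
    · simp
    · exact (Nat.pow_log_le_self 2 hj.ne').trans (Nat.le_succ j)
  rw [pow_succ _ (Nat.log 2 j + 1)]
  omega

/-- A lower triangular matrix dominated by the Hankel matrix of `c` multiplies nuclear matrices
into `S_p`. -/
theorem exists_isSchatten_triangular_hadamard {p : ℝ} (hp0 : 0 < p) (hp1 : p ≤ 1) {c : ℕ → ℂ}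
    (hc : DyadicCondition p c) {d B : Matrix ℕ ℕ ℂ}
    (hd : ∀ j k, ‖d j k‖ ≤ if k ≤ j then ‖c (j + k)‖ else 0) (hB : IsNuclear B) :
    ∃ T : Ell2 →L[ℂ] Ell2, matrixOf T = Matrix.hadamard d B ∧ IsSchatten p T := by
  have hrow := summable_row_of_triangular hd
  rcases hp1.eq_or_lt with rfl | hlt
  · obtain ⟨C, hC⟩ := hc.1 rfl
    obtain ⟨T, hT, hTs⟩ := exists_summable_approxNumber_hadamard (fun j => (hrow j).1)
      (fun j => (hrow j).2.trans (hC _)) hB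
    exact ⟨T, hT, hTs.congr fun n => (Real.rpow_one _).symm⟩
  · set r := p / (1 - p) with hr
    have hr0 : 0 < r := div_pos hp0 (by linarith)
    have hS := hc.2 hlt
    set b : ℕ → ℝ := fun n => dyadicEnergy c n ^ (r / 2) with hb
    have hb0 : ∀ n, 0 ≤ b n := fun n => Real.rpow_nonneg (dyadicEnergy_nonneg c n) _
    have hbs : Summable b := Summable.of_nonneg_of_le hb0
      (fun n => le_mul_of_one_le_left (hb0 n) (one_le_pow₀ one_le_two)) hS
    set τ : ℕ → ℝ := fun n => ∑' l, b (l + n) with hτ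
    have hτ0 : ∀ n, 0 ≤ τ n := fun n => tsum_nonneg fun _ => hb0 _
    have hrec : ∀ n, τ n = b n + τ (n + 1) := fun n => tsum_tail_eq_add hbs n
    have hanti : Antitone fun j => τ (Nat.log 2 j) :=
      (antitone_nat_of_succ_le (f := τ) fun n => by linarith [hrec n, hb0 n]).comp_monotone
        (Nat.log_monotone (b := 2))
    have hpow : ∀ j, (τ (Nat.log 2 j) ^ (1 / r)) ^ r = τ (Nat.log 2 j) := fun j => by
      rw [← Real.rpow_mul (hτ0 _), one_div_mul_cancel hr0.ne', Real.rpow_one]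
    -- The tails `τ` of `∑ b n`, where `b n = E_n ^ (r / 2)`, decrease and dominate `b`, so that
    -- `ρ j = τ (log₂ j) ^ (1 / r)` is a decreasing majorant of the row norms.
    refine exists_isSchatten_hadamard hp0 hlt (ρ := fun j => τ (Nat.log 2 j) ^ (1 / r))
      (fun j => Real.rpow_nonneg (hτ0 _) _)
      (fun i j h => Real.rpow_le_rpow (hτ0 _) (hanti h) (by positivity)) ?_
      (fun j => (hrow j).1) (fun j => (hrow j).2.trans ?_) hB
    · rw [← hr]
      simp only [hpow]
      refine (summable_condensed_iff_of_nonneg (fun j => hτ0 _) fun m n _ h => hanti h).1 ?_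
      simp only [Nat.log_pow one_lt_two]
      exact summable_two_pow_mul_tsum_tail hb0 hS
    · have hE := dyadicEnergy_nonneg c (Nat.log 2 j)
      have h1 : dyadicEnergy c (Nat.log 2 j) = b (Nat.log 2 j) ^ (2 / r) := by
        rw [hb, ← Real.rpow_mul hE, div_mul_div_cancel₀ two_ne_zero, div_self hr0.ne', Real.rpow_one]
      have h2 : (τ (Nat.log 2 j) ^ (1 / r)) ^ 2 = τ (Nat.log 2 j) ^ (2 / r) := by
        rw [← Real.rpow_natCast, ← Real.rpow_mul (hτ0 _)]
        congr 1
        push_cast; ring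
      rw [h1, h2]
      exact Real.rpow_le_rpow (hb0 _) (by linarith [hrec (Nat.log 2 j), hτ0 (Nat.log 2 j + 1)])
        (by positivity)

theorem hankel_mem_schurMultipliers {p : ℝ} (hp0 : 0 < p) (hp1 : p ≤ 1) {c : ℕ → ℂ}
    (hc : DyadicCondition p c) :
    (Matrix.of fun j k => c (j + k)) ∈ schurMultipliers p := by
  rintro _ ⟨T, hT, rfl⟩
  -- `T₁` is the lower triangle of the product, `T₂` the adjoint of its strictly upper triangle.
  obtain ⟨T₁, hT₁, hs₁⟩ := exists_isSchatten_triangular_hadamard hp0 hp1 hc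
    (d := Matrix.of fun j k => if k ≤ j then c (j + k) else 0)
    (fun j k => by by_cases h : k ≤ j <;> simp [h])
    (isNuclear_of_summable T (hT.summable_approxNumber hp0 hp1))
  obtain ⟨T₂, hT₂, hs₂⟩ := exists_isSchatten_triangular_hadamard hp0 hp1 hc
    (d := Matrix.of fun j k => if k < j then (starRingEnd ℂ) (c (j + k)) else 0)
    (fun j k => by
      by_cases h : k < j
      · simp [h, h.le]
      · simp only [Matrix.of_apply, h, if_false, norm_zero]; split_ifs <;> simp)
    (isNuclear_of_summable _ ((hT.adjoint hp0).summable_approxNumber hp0 hp1))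
  refine ⟨T₁ + ContinuousLinearMap.adjoint T₂, hs₁.add hp0 hp1 (hs₂.adjoint hp0), ?_⟩
  ext j k
  rw [matrixOf_add, Matrix.add_apply, matrixOf_adjoint, hT₁, hT₂]
  simp only [Matrix.hadamard_apply, Matrix.of_apply, matrixOf_adjoint, map_mul]
  by_cases h : k ≤ j
  · simp [h, not_lt.2 h]
  · simp [h, not_le.1 h, add_comm]

/-! ### Fourier coefficients and Besov norms -/

theorem reflect_sum_smul_zpow (s : Finset ℕ) (a : ℕ → ℂ) (t : Torus) :
    reflect (∑ k ∈ s, a k • zpow (k : ℤ)) t =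
      ∑ k ∈ s, (a k * fourier (k : ℤ) t) • zpow (-(k : ℤ)) := by
  refine Subtype.ext (funext fun x => ?_)
  have h : ∀ (z : ℕ → ℤ) (e : ℕ → ℂ) (y : Torus),
      (∑ k ∈ s, e k • zpow (z k) : TestFunction).1 y = ∑ k ∈ s, e k * fourier (z k) y := by
    intro z e y
    rw [Submodule.coe_sum, Finset.sum_apply]
    rfl
  change (∑ k ∈ s, a k • zpow (k : ℤ) : TestFunction).1 (t - x) = _
  rw [h (fun k => (k : ℤ)), h (fun k => -(k : ℤ))]
  refine Finset.sum_congr rfl fun k _ => ?_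
  rw [mul_assoc]
  congr 1
  simp only [fourier_apply, sub_eq_add_neg, smul_add, AddCircle.toCircle_add, Circle.coe_mul,
    smul_neg, neg_smul]

theorem conv_sum_smul_zpow (ψ : CircleDistribution) (s : Finset ℕ) (a : ℕ → ℂ) :
    ψ.conv (∑ k ∈ s, a k • zpow (k : ℤ)) =
      fun t => ∑ k ∈ s, (a k * ψ.coeff k) * fourier (k : ℤ) t := by
  funext t
  simp only [CircleDistribution.conv, reflect_sum_smul_zpow, map_sum, map_smul, smul_eq_mul,
    CircleDistribution.coeff]
  exact Finset.sum_congr rfl fun k _ => by ring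

/-- Parseval's identity for a trigonometric polynomial. -/
theorem toReal_eLpNorm_sum_fourier_sq (s : Finset ℕ) (a : ℕ → ℂ) :
    (MeasureTheory.eLpNorm (fun t : Torus => ∑ k ∈ s, a k * fourier (k : ℤ) t) 2
      (AddCircle.haarAddCircle : MeasureTheory.Measure Torus)).toReal ^ 2 =
      ∑ k ∈ s, ‖a k‖ ^ 2 := by
  set f : C(Torus, ℂ) := ∑ k ∈ s, a k • fourier (k : ℤ) with hf
  have hfe : (fun t : Torus => ∑ k ∈ s, a k * fourier (k : ℤ) t) = f := by
    funext t; simp [hf]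
  have h1 := ContinuousMap.coeFn_toLp (p := 2) (𝕜 := ℂ)
    (AddCircle.haarAddCircle : MeasureTheory.Measure Torus) f
  rw [hfe, ← MeasureTheory.eLpNorm_congr_ae h1, ← MeasureTheory.Lp.norm_def]
  have h2 : ContinuousMap.toLp 2 (AddCircle.haarAddCircle : MeasureTheory.Measure Torus) ℂ f =
      ∑ k ∈ s, a k • fourierLp 2 (k : ℤ) := by
    rw [hf, map_sum]; simp only [map_smul]
  have hon : Orthonormal ℂ fun k : ℕ => (fourierLp 2 (k : ℤ) :
      MeasureTheory.Lp ℂ 2 (AddCircle.haarAddCircle : MeasureTheory.Measure Torus)) :=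
    orthonormal_fourier.comp _ Nat.cast_injective
  rw [h2]
  have h3 := hon.inner_sum a a s
  rw [inner_self_eq_norm_sq_to_K] at h3
  have h4 : ∀ z : ℂ, (starRingEnd ℂ) z * z = ((‖z‖ ^ 2 : ℝ) : ℂ) := fun z => by
    rw [Complex.conj_mul']; push_cast; rfl
  simp only [h4] at h3
  refine Complex.ofReal_injective ?_
  rw [Complex.ofReal_pow, Complex.ofReal_sum]
  exact h3

/-- The norm `‖ψ * V_n‖_{L²}`. -/
def blockNorm (v : ℝ → ℝ) (ψ : CircleDistribution) (n : ℤ) : ℝ :=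
  (MeasureTheory.eLpNorm (ψ.conv (dyadicKernel v n)) 2
    (AddCircle.haarAddCircle : MeasureTheory.Measure Torus)).toReal

theorem blockNorm_nonneg (v : ℝ → ℝ) (ψ : CircleDistribution) (n : ℤ) : 0 ≤ blockNorm v ψ n :=
  ENNReal.toReal_nonneg

theorem blockNorm_sq (v : ℝ → ℝ) (ψ : CircleDistribution) {n : ℕ} (hn : n ≠ 0) :
    blockNorm v ψ n ^ 2 =
      ∑ k ∈ Finset.range (2 ^ (n + 1) + 1), v (k / 2 ^ n) ^ 2 * ‖ψ.coeff k‖ ^ 2 := by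
  have h1 : dyadicKernel v n = ∑ k ∈ Finset.range (2 ^ (n + 1) + 1),
      ((v ((k : ℝ) / 2 ^ n) : ℝ) : ℂ) • zpow (k : ℤ) := by
    rw [dyadicKernel, if_neg (by exact_mod_cast hn)]
    simp [Int.sign_natCast_of_ne_zero hn]
  rw [blockNorm, h1, conv_sum_smul_zpow, toReal_eLpNorm_sum_fourier_sq]
  refine Finset.sum_congr rfl fun k _ => ?_
  rw [norm_mul, mul_pow, Complex.norm_real, Real.norm_eq_abs, sq_abs]

namespace IsDyadicBump

variable {v : ℝ → ℝ}

theorem mem_Icc_of_ne_zero (hv : IsDyadicBump v) {x : ℝ} (hx : v x ≠ 0) :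
    x ∈ Set.Icc (1 / 2 : ℝ) 2 := hv.supp ▸ subset_tsupport v hx

/-- By the support condition only four terms of the partition of unity are nonzero at `m`, so
Cauchy–Schwarz bounds the sum of their squares from below by `1 / 4`. -/
theorem one_le_four_mul_sum_sq (hv : IsDyadicBump v) {n m : ℕ} (h1 : 2 ^ (n + 2) - 1 ≤ m)
    (h2 : m < 2 ^ (n + 4)) :
    1 ≤ 4 * ∑ i ∈ Finset.range 4, v (m / 2 ^ (n + 1 + i)) ^ 2 := by
  have hp : 0 < 2 ^ n := by positivity
  have e2 : 2 ^ (n + 2) = 4 * 2 ^ n := by ring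
  have e4 : 2 ^ (n + 4) = 16 * 2 ^ n := by ring
  have hm1 : (1 : ℝ) ≤ m := by
    have : 1 ≤ m := by omega
    exact_mod_cast this
  have hlow : (3 : ℝ) * 2 ^ n ≤ m := by
    have : 3 * 2 ^ n ≤ m := by omega
    exact_mod_cast this
  have hupp : (m : ℝ) < 16 * 2 ^ n := by
    rw [e4] at h2
    exact_mod_cast h2
  have hzero : ∀ l ∉ Finset.Ico (n + 1) (n + 5), v (m / 2 ^ l) = 0 := by
    intro l hl
    by_contra hne
    obtain ⟨ha, hb⟩ := hv.mem_Icc_of_ne_zero hne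
    have hl0 : (0 : ℝ) < 2 ^ l := by positivity
    rw [div_le_div_iff₀ two_pos hl0] at ha
    rw [div_le_iff₀ hl0] at hb
    rw [Finset.mem_Ico, not_and_or, not_le, not_lt] at hl
    rcases hl with hl | hl
    · have : (2 : ℝ) ^ l ≤ 2 ^ n := pow_le_pow_right₀ one_le_two (by omega)
      have : (0 : ℝ) < 2 ^ n := by positivity
      linarith
    · have : (2 : ℝ) ^ (n + 5) ≤ 2 ^ l := pow_le_pow_right₀ one_le_two hl
      have : (2 : ℝ) ^ (n + 5) = 32 * 2 ^ n := by ring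
      linarith
  have hsum := (hv.hasSum m hm1).unique (hasSum_sum_of_ne_finset_zero hzero)
  rw [Finset.sum_Ico_eq_sum_range, show n + 5 - (n + 1) = 4 by omega] at hsum
  have h := sq_sum_le_card_mul_sum_sq (s := Finset.range 4)
    (f := fun i => v (m / 2 ^ (n + 1 + i)))
  rw [← hsum] at h
  simpa using h

theorem dyadicEnergy_le (hv : IsDyadicBump v) (ψ : CircleDistribution) (n : ℕ) :
    dyadicEnergy (fun m => ψ.coeff m) (n + 2) ≤
      4 * ∑ i ∈ Finset.range 4, blockNorm v ψ ((n + 1 + i : ℕ) : ℤ) ^ 2 := by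
  have h1 : ∀ i, ∑ m ∈ Finset.Ico (α := ℕ) (2 ^ (n + 2) - 1) (2 ^ (n + 2 + 2)),
      v (m / 2 ^ (n + 1 + i)) ^ 2 * ‖ψ.coeff m‖ ^ 2 ≤ blockNorm v ψ ((n + 1 + i : ℕ) : ℤ) ^ 2 := by
    intro i
    rw [blockNorm_sq v ψ (by omega), ← Finset.sum_filter_ne_zero]
    refine Finset.sum_le_sum_of_subset_of_nonneg (fun m hm => ?_) fun _ _ _ => by positivity
    have hne : v (m / 2 ^ (n + 1 + i)) ≠ 0 := by
      intro h
      exact (Finset.mem_filter.1 hm).2 (by simp [h])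
    have hb := (hv.mem_Icc_of_ne_zero hne).2
    rw [div_le_iff₀ (by positivity), ← pow_succ'] at hb
    rw [Finset.mem_range, Nat.lt_succ_iff]
    exact_mod_cast hb
  calc dyadicEnergy (fun m => ψ.coeff m) (n + 2)
      ≤ ∑ m ∈ Finset.Ico (α := ℕ) (2 ^ (n + 2) - 1) (2 ^ (n + 2 + 2)),
          4 * ∑ i ∈ Finset.range 4, v (m / 2 ^ (n + 1 + i)) ^ 2 * ‖ψ.coeff m‖ ^ 2 := by
        refine Finset.sum_le_sum fun m hm => ?_
        rw [← Finset.sum_mul, ← mul_assoc]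
        exact le_mul_of_one_le_left (sq_nonneg _) (hv.one_le_four_mul_sum_sq
          (Finset.mem_Ico.1 hm).1 (Finset.mem_Ico.1 hm).2)
    _ = 4 * ∑ i ∈ Finset.range 4, ∑ m ∈ Finset.Ico (α := ℕ) (2 ^ (n + 2) - 1) (2 ^ (n + 2 + 2)),
          v (m / 2 ^ (n + 1 + i)) ^ 2 * ‖ψ.coeff m‖ ^ 2 := by
        rw [← Finset.mul_sum, Finset.sum_comm]
    _ ≤ _ := by gcongr with i; exact h1 i

end IsDyadicBump

theorem rpow_sum_le {ι : Type} (s : Finset ι) (a : ι → ℝ) (ha : ∀ i, 0 ≤ a i) {e : ℝ} (he : 0 < e) :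
    (∑ i ∈ s, a i) ^ e ≤ (s.card : ℝ) ^ e * ∑ i ∈ s, a i ^ e := by
  rcases s.eq_empty_or_nonempty with rfl | hs
  · simp [Real.zero_rpow he.ne']
  obtain ⟨i, hi, hmax⟩ := s.exists_max_image a hs
  have h1 : ∑ i ∈ s, a i ≤ s.card * a i := by
    simpa [nsmul_eq_mul] using Finset.sum_le_card_nsmul s a (a i) hmax
  refine (Real.rpow_le_rpow (Finset.sum_nonneg fun i _ => ha i) h1 he.le).trans ?_
  rw [Real.mul_rpow (Nat.cast_nonneg _) (ha i)]
  exact mul_le_mul_of_nonneg_left (Finset.single_le_sum (f := fun i => a i ^ e)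
    (fun i _ => Real.rpow_nonneg (ha i) e) hi) (Real.rpow_nonneg (Nat.cast_nonneg _) _)

theorem dyadicCondition_of_mem_besov {v : ℝ → ℝ} (hv : IsDyadicBump v) {p : ℝ} (hp0 : 0 < p)
    {ψ : CircleDistribution} (hψ : ψ ∈ besov v (1 / sharp p).toReal 2 (sharp p)) :
    DyadicCondition p fun m => ψ.coeff m := by
  have hmem : Memℓp (fun n : ℤ => (2 : ℝ) ^ ((n.natAbs : ℝ) * (1 / sharp p).toReal) *
    blockNorm v ψ n) (sharp p) := hψ
  constructor
  · rintro rfl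
    have hs : sharp 1 = ⊤ := if_pos rfl
    rw [hs] at hmem
    obtain ⟨M, hM⟩ := memℓp_infty_iff.1 hmem
    have hW : ∀ n, blockNorm v ψ n ≤ M := fun n => by
      have := hM ⟨n, rfl⟩
      simpa [abs_of_nonneg (blockNorm_nonneg v ψ n)] using this
    refine ⟨max (max (dyadicEnergy (fun m => ψ.coeff m) 0) (dyadicEnergy (fun m => ψ.coeff m) 1))
      (4 * ∑ i ∈ Finset.range 4, M ^ 2), fun n => ?_⟩
    match n with
    | 0 => exact (le_max_left _ _).trans (le_max_left _ _)
    | 1 => exact (le_max_right _ _).trans (le_max_left _ _)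
    -- The kernel `V_0`, which is not of the form `∑ v(k) z^k`, does not occur for blocks `n ≥ 2`.
    | n + 2 =>
      refine (hv.dyadicEnergy_le ψ n).trans (le_trans ?_ (le_max_right _ _))
      gcongr with i
      · exact blockNorm_nonneg _ _ _
      · exact hW _
  · intro hp1
    set r := p / (1 - p) with hr
    have hr0 : 0 < r := div_pos hp0 (by linarith)
    have hs : sharp p = ENNReal.ofReal r := if_neg hp1.ne
    have hsr : (sharp p).toReal = r := by rw [hs, ENNReal.toReal_ofReal hr0.le]
    have hinv : (1 / sharp p).toReal = 1 / r := by rw [ENNReal.toReal_div, hsr]; simp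
    have hsum : Summable fun n : ℕ => (2 : ℝ) ^ n * blockNorm v ψ (n : ℤ) ^ r := by
      have h1 := (memℓp_gen_iff (by rw [hsr]; exact hr0)).1 hmem
      refine (h1.comp_injective Nat.cast_injective).congr fun n => ?_
      have hW := blockNorm_nonneg v ψ n
      simp only [Function.comp_apply, hsr, hinv, Int.natAbs_natCast]
      rw [Real.norm_of_nonneg (by positivity), Real.mul_rpow (by positivity) hW,
        ← Real.rpow_mul (by norm_num), mul_assoc, one_div_mul_cancel hr0.ne', mul_one,
        Real.rpow_natCast]
    refine (summable_nat_add_iff 2).1 ?_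
    have hmaj : Summable fun n : ℕ => 2 * ((4 : ℝ) ^ (r / 2) * (4 : ℝ) ^ (r / 2) *
        ∑ i ∈ Finset.range 4, (2 : ℝ) ^ (n + (1 + i)) *
          blockNorm v ψ ((n + (1 + i) : ℕ) : ℤ) ^ r) :=
      ((summable_sum fun i _ => (summable_nat_add_iff (1 + i)).2 hsum).mul_left _).mul_left _
    refine Summable.of_nonneg_of_le (fun n => mul_nonneg (by positivity)
      (Real.rpow_nonneg (dyadicEnergy_nonneg _ _) _)) (fun n => ?_) hmaj
    have hW : ∀ i : ℕ, 0 ≤ blockNorm v ψ ((n + 1 + i : ℕ) : ℤ) := fun i => blockNorm_nonneg _ _ _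
    have h1 : dyadicEnergy (fun m => ψ.coeff m) (n + 2) ^ (r / 2) ≤ (4 : ℝ) ^ (r / 2) *
        ((4 : ℝ) ^ (r / 2) * ∑ i ∈ Finset.range 4, blockNorm v ψ ((n + 1 + i : ℕ) : ℤ) ^ r) := by
      refine (Real.rpow_le_rpow (dyadicEnergy_nonneg _ _) (hv.dyadicEnergy_le ψ n)
        (by positivity)).trans ?_
      rw [Real.mul_rpow (by norm_num) (Finset.sum_nonneg fun _ _ => sq_nonneg _)]
      refine mul_le_mul_of_nonneg_left ?_ (by positivity)
      refine (rpow_sum_le (Finset.range 4) _ (fun _ => sq_nonneg _) (half_pos hr0)).trans ?_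
      rw [Finset.card_range]
      refine mul_le_mul_of_nonneg_left (Finset.sum_le_sum fun i _ => ?_) (by positivity)
      rw [← Real.rpow_natCast, ← Real.rpow_mul (hW i)]
      exact le_of_eq (by congr 1; push_cast; ring)
    refine (mul_le_mul_of_nonneg_left h1 (by positivity)).trans ?_
    rw [mul_assoc (4 ^ (r / 2) : ℝ), mul_left_comm, mul_left_comm ((2 : ℝ) ^ (n + 2)),
      mul_left_comm (2 : ℝ), mul_left_comm (2 : ℝ)]
    refine mul_le_mul_of_nonneg_left (mul_le_mul_of_nonneg_left ?_ (by positivity)) (by positivity)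
    rw [Finset.mul_sum, Finset.mul_sum]
    refine Finset.sum_le_sum fun i _ => ?_
    rw [← mul_assoc, ← pow_succ', add_assoc n 1 i]
    refine mul_le_mul_of_nonneg_right (pow_le_pow_right₀ one_le_two (by omega))
      (Real.rpow_nonneg (blockNorm_nonneg _ _ _) _)

end HankelSchur

end

theorem theorem4 (v : ℝ → ℝ) (hv : HankelSchur.IsDyadicBump v)
    (p : ℝ) (hp0 : 0 < p) (hp1 : p ≤ 1)
    (ψ : HankelSchur.CircleDistribution)
    (hψ : ψ ∈ HankelSchur.besov v (1 / HankelSchur.sharp p).toReal 2 (HankelSchur.sharp p)) :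
    HankelSchur.hankel ψ ∈ HankelSchur.schurMultipliers p := by
  have h := HankelSchur.hankel_mem_schurMultipliers hp0 hp1
    (HankelSchur.dyadicCondition_of_mem_besov hv hp0 hψ)
  simpa only [HankelSchur.hankel, Nat.cast_add] using h
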